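/- Let $k\ge 1$, let $K_k$ be the complete graph with vertex set $\{v_1,\dots,v_k\}$, and let $\omega$ be a real-valued weight function on its edge set. Let $\tau(K_k,\omega)=\sum_{T}\prod_{e\in E(T)}\omega(e)$, where $T$ runs over all spanning trees of $K_k$ (an empty product is $1$). In the $2k$ variables $x_1,\dots,x_k,y_1,\dots,y_k$ consider, with $X=x_1+\dots+x_k$ and $Y=y_1+\dots+y_k$, the rational function $$\phi(x_1,y_1,\dots,x_k,y_k)=\frac{1}{XY}\left(\prod_{i=1}^k (x_iY+y_iX)\right)\left(1-\sum_{i=1}^k\frac{x_iy_i}{x_iY+y_iX}\right),$$ which is in fact a polynomial in these variables; its value at arbitrary real numbers (also where a denominator vanishes) means the value of this polynomial. If there are real numbers $x_1,\dots,x_k,y_1,\dots,y_k$ such that $\omega(v_iv_j)=x_iy_j+x_jy_i$ for all $1\le i<j\le k$, then $$\tau(K_k,\omega)=\phi(x_1,y_1,\dots,x_k,y_k).$$ -/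

import Mathlib

open scoped Classical in
/-- The weighted spanning-tree sum `τ(G, ω) = ∑_T ∏_{e ∈ E(T)} ω(e)`, where `T` runs over the
spanning trees of the finite graph `G` (the trees on the whole vertex set all of whose edges are
edges of `G`). Only the values of `ω` on edges of `G` enter the sum. -/
noncomputable def weightedTreeSum {V : Type*} [Fintype V] (G : SimpleGraph V)
    (ω : Sym2 V → ℝ) : ℝ :=
  ∑ T : SimpleGraph V with T ≤ G ∧ T.IsTree, ∏ e ∈ T.edgeFinset, ω e

/-- Polynomials with real coefficients in the `2k` variables `x_i` (left summand) and `y_i`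
(right summand). -/
abbrev XYPoly (k : ℕ) : Type := MvPolynomial (Fin k ⊕ Fin k) ℝ

/-- Rational functions in the `2k` variables `x_i`, `y_i`. -/
abbrev XYRat (k : ℕ) : Type := FractionRing (XYPoly k)

/-- The variable `x_i`. -/
noncomputable def xVar {k : ℕ} (i : Fin k) : XYPoly k := MvPolynomial.X (Sum.inl i)

/-- The variable `y_i`. -/
noncomputable def yVar {k : ℕ} (i : Fin k) : XYPoly k := MvPolynomial.X (Sum.inr i)

/-- The rational function
`(1 / (X Y)) * ∏ (x_i Y + y_i X) * (1 - ∑ x_i y_i / (x_i Y + y_i X))`,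
with `X = ∑ x_i` and `Y = ∑ y_i`. -/
noncomputable def phiRat (k : ℕ) : XYRat k :=
  let x : Fin k → XYRat k := fun i => algebraMap (XYPoly k) (XYRat k) (xVar i)
  let y : Fin k → XYRat k := fun i => algebraMap (XYPoly k) (XYRat k) (yVar i)
  let X : XYRat k := ∑ i, x i
  let Y : XYRat k := ∑ i, y i
  1 / (X * Y) * (∏ i, (x i * Y + y i * X)) * (1 - ∑ i, x i * y i / (x i * Y + y i * X))

theorem prod_eq_of_mul_eq_zero {R ι : Type*} [CommRing R] (a b : ι → R) (A B : R)
    (h : A * B = 0) (s : Finset ι) (hs : s.Nonempty) :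
    ∏ i ∈ s, (a i * B + b i * A)
      = B ^ s.card * ∏ i ∈ s, a i + A ^ s.card * ∏ i ∈ s, b i := by
  induction hs using Finset.Nonempty.cons_induction with
  | singleton i => simp; ring
  | cons i s hi hs ih =>
    have hc : s.card ≠ 0 := by simpa using hs.ne_empty
    obtain ⟨n, hn⟩ : ∃ n, s.card = n + 1 := Nat.exists_eq_succ_of_ne_zero hc
    rw [Finset.prod_cons, ih, Finset.prod_cons, Finset.prod_cons, Finset.card_cons, hn]
    linear_combination (a i * A ^ n * (∏ i ∈ s, b i) + b i * B ^ n * ∏ i ∈ s, a i) * h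

theorem numerator_eq_zero_of_mul_eq_zero {R : Type*} [CommRing R] {k : ℕ} (a b : Fin k → R)
    (h : (∑ i, a i) * (∑ i, b i) = 0) (hk : 1 ≤ k) :
    ∏ i, (a i * (∑ i, b i) + b i * ∑ i, a i)
      - ∑ i, a i * b i * ∏ j ∈ Finset.univ.erase i, (a j * (∑ i, b i) + b j * ∑ i, a i) = 0 := by
  obtain ⟨n, rfl⟩ : ∃ n, k = n + 1 := ⟨k - 1, by omega⟩
  rcases n with _ | n
  · simp at h ⊢
    linear_combination h
  · rw [prod_eq_of_mul_eq_zero a b _ _ h _ Finset.univ_nonempty]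
    have key : ∀ i : Fin (n + 1 + 1),
        a i * b i * ∏ j ∈ Finset.univ.erase i, (a j * (∑ i, b i) + b j * ∑ i, a i)
          = b i * ((∑ i, b i) ^ (n + 1) * ∏ j, a j) + a i * ((∑ i, a i) ^ (n + 1) * ∏ j, b j) := by
      intro i
      have hne : (Finset.univ.erase i).Nonempty := by
        rw [← Finset.card_pos, Finset.card_erase_of_mem (Finset.mem_univ _)]
        simp
      rw [prod_eq_of_mul_eq_zero a b _ _ h _ hne,
        ← Finset.mul_prod_erase Finset.univ a (Finset.mem_univ i),
        ← Finset.mul_prod_erase Finset.univ b (Finset.mem_univ i),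
        Finset.card_erase_of_mem (Finset.mem_univ _)]
      simp only [Finset.card_univ, Fintype.card_fin, Nat.add_sub_cancel]
      ring
    rw [Finset.sum_congr rfl fun i _ => key i, Finset.sum_add_distrib, ← Finset.sum_mul,
      ← Finset.sum_mul]
    simp only [Finset.card_univ, Fintype.card_fin]
    ring

theorem sum_xVar_ne_zero {k : ℕ} (hk : 1 ≤ k) : (∑ i : Fin k, xVar i) ≠ 0 := by
  intro h
  have := congrArg (MvPolynomial.eval (fun _ => (1 : ℝ))) h
  simp [xVar] at this
  omega

theorem sum_yVar_ne_zero {k : ℕ} (hk : 1 ≤ k) : (∑ i : Fin k, yVar i) ≠ 0 := by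
  intro h
  have := congrArg (MvPolynomial.eval (fun _ => (1 : ℝ))) h
  simp [yVar] at this
  omega

theorem denominator_ne_zero {k : ℕ} (i : Fin k) :
    xVar i * (∑ j, yVar j) + yVar i * (∑ j, xVar j) ≠ 0 := by
  intro h
  have := congrArg (MvPolynomial.eval (fun _ => (1 : ℝ))) h
  simp [xVar, yVar] at this
  have := i.2
  omega

/-- The rational function `phiRat k` is a polynomial. -/
theorem exists_algebraMap_eq_phiRat (k : ℕ) :
    ∃ P : XYPoly k, algebraMap (XYPoly k) (XYRat k) P = phiRat k := by
  rcases Nat.eq_zero_or_pos k with rfl | hk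
  · exact ⟨0, by simp [phiRat]⟩
  have hdvd : (∑ i : Fin k, xVar i) * (∑ i : Fin k, yVar i) ∣
      ∏ i : Fin k, (xVar i * (∑ i, yVar i) + yVar i * ∑ i, xVar i)
      - ∑ i : Fin k, xVar i * yVar i * ∏ j ∈ Finset.univ.erase i,
          (xVar j * (∑ i, yVar i) + yVar j * ∑ i, xVar i) := by
    rw [← Ideal.mem_span_singleton, ← Ideal.Quotient.eq_zero_iff_mem]
    set f := Ideal.Quotient.mk
      (Ideal.span {(∑ i : Fin k, xVar i) * (∑ i : Fin k, yVar i)}) with hf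
    have h0 : (∑ i : Fin k, f (xVar i)) * (∑ i : Fin k, f (yVar i)) = 0 := by
      rw [← map_sum, ← map_sum, ← map_mul, hf, Ideal.Quotient.eq_zero_iff_mem]
      exact Ideal.mem_span_singleton_self _
    have := numerator_eq_zero_of_mul_eq_zero _ _ h0 hk
    simpa only [map_sub, map_prod, map_add, map_mul, map_sum] using this
  obtain ⟨P, hP⟩ := hdvd
  refine ⟨P, ?_⟩
  have inj := IsFractionRing.injective (XYPoly k) (XYRat k)
  have hX := (map_ne_zero_iff _ inj).2 (sum_xVar_ne_zero hk)
  have hY := (map_ne_zero_iff _ inj).2 (sum_yVar_ne_zero hk)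
  have hW := fun i : Fin k => (map_ne_zero_iff _ inj).2 (denominator_ne_zero i)
  have hP' := congrArg (algebraMap (XYPoly k) (XYRat k)) hP
  simp only [map_sub, map_prod, map_add, map_mul, map_sum] at hP' hX hY hW
  simp only [phiRat]
  rw [one_div, mul_assoc, eq_inv_mul_iff_mul_eq₀ (mul_ne_zero hX hY), ← hP', mul_sub, mul_one,
    Finset.mul_sum]
  congr 1
  refine Finset.sum_congr rfl fun i _ => ?_
  rw [← Finset.mul_prod_erase Finset.univ _ (Finset.mem_univ i)]
  have aux : ∀ w p c : XYRat k, w ≠ 0 → c * p = w * p * (c / w) := by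
    intro w p c hw
    field_simp
  exact aux _ _ _ (hW i)

/-- The polynomial `φ` in `x_1, y_1, …, x_k, y_k`: the (unique) polynomial which, as a rational
function, is equal to `phiRat k`. -/
noncomputable def phiPoly (k : ℕ) : XYPoly k := (exists_algebraMap_eq_phiRat k).choose

theorem algebraMap_phiPoly (k : ℕ) :
    algebraMap (XYPoly k) (XYRat k) (phiPoly k) = phiRat k :=
  (exists_algebraMap_eq_phiRat k).choose_spec

/-- The value `φ(x_1, y_1, …, x_k, y_k)` of the polynomial `φ` at real numbers. -/
noncomputable def phi {k : ℕ} (x y : Fin k → ℝ) : ℝ :=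
  MvPolynomial.eval (Sum.elim x y) (phiPoly k)

/-! Both sides are polynomials in the `x i`, `y i`, so it suffices to compare them at indeterminates
in the fraction field, where `X`, `Y` and all `w i = x i * Y + y i * X` are nonzero, and then to
evaluate (`phiPoly_eq_treeSum`). There `treeSum_eq_det` turns the tree sum into a reduced Laplacian
determinant. With loops of weight `2 * x i * y i` allowed, which cancel, the Laplacian is `diag(w)`
minus the rank two matrix `x yᵀ + y xᵀ`, so `det_diagonal_sub_rank_two` leaves a 2×2 determinant. -/

open scoped Classical in
/-- The sum over all trees on the vertex set `V` of the products of the edge weights. -/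
noncomputable def treeSum {V R : Type*} [Fintype V] [CommRing R] (ω : Sym2 V → R) : R :=
  ∑ T : SimpleGraph V with T.IsTree, ∏ e ∈ T.edgeFinset, ω e

theorem map_treeSum {V R S : Type*} [Fintype V] [CommRing R] [CommRing S] (g : R →+* S)
    (ω : Sym2 V → R) : g (treeSum ω) = treeSum fun e => g (ω e) := by
  simp only [treeSum, map_sum, map_prod]

/-- Trees have no loops, so the values on the diagonal may be chosen freely. -/
theorem weightedTreeSum_top_eq_treeSum {V : Type*} [Fintype V] {ω ω' : Sym2 V → ℝ}
    (h : ∀ e : Sym2 V, ¬ e.IsDiag → ω e = ω' e) :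
    weightedTreeSum (⊤ : SimpleGraph V) ω = treeSum ω' := by
  classical
  rw [weightedTreeSum, treeSum]
  refine Finset.sum_congr (by ext; simp) fun T _ => Finset.prod_congr rfl fun e he => h e ?_
  exact T.not_isDiag_of_mem_edgeSet (SimpleGraph.mem_edgeFinset.1 he)

/-! ### Trees as parent maps towards a root -/

section ParentMaps

variable {V : Type*} {r : V}

/-- The graph whose edges join each vertex `i ≠ r` to its parent `f i`. -/
def parentGraph (f : {v // v ≠ r} → V) : SimpleGraph V :=
  SimpleGraph.fromEdgeSet (Set.range fun i => s(i.1, f i))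

/-- A parent map is ranked if some rank function decreases strictly from each vertex to its
parent. -/
def IsRanked (f : {v // v ≠ r} → V) : Prop :=
  ∃ d : V → ℕ, ∀ i, d (f i) < d i

theorem IsRanked.ne {f : {v // v ≠ r} → V} (hf : IsRanked f) (i : {v // v ≠ r}) :
    (i : V) ≠ f i := by
  obtain ⟨d, hd⟩ := hf
  intro h
  have := hd i
  rw [← h] at this
  exact lt_irrefl _ this

theorem IsRanked.edgeSet_parentGraph {f : {v // v ≠ r} → V} (hf : IsRanked f) :
    (parentGraph f).edgeSet = Set.range fun i => s(i.1, f i) := by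
  rw [parentGraph, SimpleGraph.edgeSet_fromEdgeSet, sdiff_eq_left, Set.disjoint_left]
  rintro _ ⟨i, rfl⟩ h
  exact hf.ne i (by simpa using h)

theorem IsRanked.adj {f : {v // v ≠ r} → V} (hf : IsRanked f) (i : {v // v ≠ r}) :
    (parentGraph f).Adj i (f i) := by
  rw [← SimpleGraph.mem_edgeSet, hf.edgeSet_parentGraph]
  exact ⟨i, rfl⟩

/-- Two vertices giving the same edge would be each other's parent, against the rank. -/
theorem IsRanked.edge_injective {f : {v // v ≠ r} → V} (hf : IsRanked f) :
    Function.Injective fun i : {v // v ≠ r} => s(i.1, f i) := by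
  obtain ⟨d, hd⟩ := hf
  intro i j h
  rcases Sym2.eq_iff.1 h with ⟨h, -⟩ | ⟨h₁, h₂⟩
  · exact Subtype.ext h
  · have hi := hd i
    have hj := hd j
    rw [h₂] at hi
    rw [← h₁] at hj
    omega

theorem IsRanked.connected {f : {v // v ≠ r} → V} (hf : IsRanked f) :
    (parentGraph f).Connected := by
  have hadj := hf.adj
  obtain ⟨d, hd⟩ := hf
  have key : ∀ n, ∀ v, d v = n → (parentGraph f).Reachable v r := by
    intro n
    induction n using Nat.strong_induction_on with
    | _ n ih =>
      rintro v rfl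
      by_cases hv : v = r
      · rw [hv]
      · exact (hadj ⟨v, hv⟩).reachable.trans (ih _ (hd ⟨v, hv⟩) _ rfl)
  have : Nonempty V := ⟨r⟩
  exact ⟨fun u v => (key _ u rfl).trans (key _ v rfl).symm⟩

theorem IsRanked.isTree [Finite V] {f : {v // v ≠ r} → V} (hf : IsRanked f) :
    (parentGraph f).IsTree := by
  classical
  have := Fintype.ofFinite V
  rw [SimpleGraph.isTree_iff_connected_and_card]
  refine ⟨hf.connected, ?_⟩
  rw [hf.edgeSet_parentGraph, Nat.card_range_of_injective hf.edge_injective,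
    Nat.card_eq_fintype_card, Nat.card_eq_fintype_card, Fintype.card_subtype_compl,
    Fintype.card_subtype_eq]
  have : 0 < Fintype.card V := Fintype.card_pos_iff.2 ⟨r⟩
  omega

/-- Induction on the rank for `f`: if the edge from `i` to `f i` came from `g j = i` with `j = f i`,
then `f j = g j = i` by induction, and the rank would drop around a 2-cycle. -/
theorem IsRanked.eq_of_parentGraph_eq {f g : {v // v ≠ r} → V} (hf : IsRanked f)
    (hg : IsRanked g) (h : parentGraph f = parentGraph g) : f = g := by
  have hadj := hf.adj
  obtain ⟨d, hd⟩ := hf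
  have key : ∀ n, ∀ i : {v // v ≠ r}, d i = n → f i = g i := by
    intro n
    induction n using Nat.strong_induction_on with
    | _ n ih =>
      rintro i rfl
      have hi := hadj i
      rw [h, ← SimpleGraph.mem_edgeSet, hg.edgeSet_parentGraph] at hi
      obtain ⟨j, hj⟩ := hi
      rcases Sym2.eq_iff.1 hj with ⟨h₁, h₂⟩ | ⟨h₁, h₂⟩
      · rw [← h₂, Subtype.ext h₁]
      · have hlt := hd i
        rw [← h₁] at hlt
        have := hd j
        rw [ih _ hlt j rfl, h₂] at this
        omega
  exact funext fun i => key _ i rfl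

/-- The parent is the next vertex on a shortest path to `r`. The parent graph lies in `T`, and both
are trees on `V`, hence have equally many edges. -/
theorem SimpleGraph.IsTree.exists_isRanked [Finite V] {T : SimpleGraph V} (hT : T.IsTree) (r : V) :
    ∃ f : {v // v ≠ r} → V, IsRanked f ∧ parentGraph f = T := by
  have hex : ∀ i : {v // v ≠ r}, ∃ w, T.Adj i w ∧ T.dist w r < T.dist i r := by
    intro i
    obtain ⟨i, hi⟩ := i
    obtain ⟨p, hp⟩ := hT.connected.exists_walk_length_eq_dist i r
    cases p with
    | nil => exact absurd rfl hi
    | @cons _ w _ hadj q =>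
      refine ⟨w, hadj, ?_⟩
      rw [← hp, SimpleGraph.Walk.length_cons]
      exact Nat.lt_succ_of_le (SimpleGraph.dist_le q)
  choose f hadj hlt using hex
  have hf : IsRanked f := ⟨fun v => T.dist v r, hlt⟩
  refine ⟨f, hf, ?_⟩
  have hle : (parentGraph f).edgeSet ⊆ T.edgeSet := by
    rw [hf.edgeSet_parentGraph]
    rintro _ ⟨i, rfl⟩
    exact hadj i
  rw [← SimpleGraph.edgeSet_inj]
  refine Set.eq_of_subset_of_ncard_le hle ?_ (Set.toFinite _)
  have h₁ := (SimpleGraph.isTree_iff_connected_and_card.1 hT).2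
  have h₂ := (SimpleGraph.isTree_iff_connected_and_card.1 hf.isTree).2
  rw [Nat.card_coe_set_eq] at h₁ h₂
  omega

open scoped Classical in
theorem treeSum_eq_sum_isRanked [Fintype V] {R : Type*} [CommRing R] (ω : Sym2 V → R) (r : V) :
    treeSum ω = ∑ f : {v // v ≠ r} → V with IsRanked f, ∏ i, ω s(i.1, f i) := by
  rw [treeSum]
  symm
  refine Finset.sum_bij (fun f _ => parentGraph f) ?_ ?_ ?_ ?_
  · intro f hf
    simp only [Finset.mem_filter, Finset.mem_univ, true_and] at hf ⊢
    exact hf.isTree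
  · intro f hf g hg h
    simp only [Finset.mem_filter, Finset.mem_univ, true_and] at hf hg
    exact hf.eq_of_parentGraph_eq hg h
  · intro T hT
    simp only [Finset.mem_filter, Finset.mem_univ, true_and] at hT
    obtain ⟨f, hf, h⟩ := hT.exists_isRanked r
    exact ⟨f, by simpa using hf, h⟩
  · intro f hf
    simp only [Finset.mem_filter, Finset.mem_univ, true_and] at hf
    have : (parentGraph f).edgeFinset = Finset.univ.image fun i => s(i.1, f i) := by
      ext e
      rw [SimpleGraph.mem_edgeFinset, hf.edgeSet_parentGraph]
      simp
    rw [this, Finset.prod_image fun i _ j _ h => hf.edge_injective h]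

/-- If a parent map is not ranked, then the set of vertices from which passing to parents never
reaches the root is nonempty and closed under taking parents and children. -/
theorem exists_invariant_set_of_not_isRanked {f : {v // v ≠ r} → V} (hf : ¬ IsRanked f) :
    ∃ C : Set V, r ∉ C ∧ C.Nonempty ∧ ∀ i, i.1 ∈ C ↔ f i ∈ C := by
  classical
  let g : V → V := fun v => if h : v ≠ r then f ⟨v, h⟩ else r
  have hg : ∀ i : {v // v ≠ r}, g i = f i := fun i => dif_pos i.2
  refine ⟨{v | ∀ n, g^[n] v ≠ r}, fun h => h 0 rfl, ?_, ?_⟩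
  · by_contra hne
    have hreach : ∀ v, ∃ n, g^[n] v = r := by
      simpa [Set.not_nonempty_iff_eq_empty, Set.eq_empty_iff_forall_notMem] using hne
    -- The number of steps to the root is a rank function.
    refine hf ⟨fun v => Nat.find (hreach v), fun i => ?_⟩
    have hi := Nat.find_spec (hreach i)
    rcases hm : Nat.find (hreach i) with _ | m
    · rw [hm] at hi
      exact absurd hi i.2
    · rw [hm, Function.iterate_succ_apply, hg] at hi
      exact (Nat.lt_succ_of_le (Nat.find_min' (hreach (f i)) hi)).trans_eq hm.symm
  · intro i
    simp only [Set.mem_ofPred_eq, ← hg, ← Function.iterate_succ_apply]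
    refine ⟨fun h n => h (n + 1), fun h n => ?_⟩
    cases n with
    | zero => exact i.2
    | succ n => exact h n

end ParentMaps

/-! ### The matrix-tree theorem -/

section MatrixTree

variable {V : Type*} [Fintype V] [DecidableEq V] {r : V} {R : Type*} [CommRing R]

theorem det_parent_of_isRanked {f : {v // v ≠ r} → V} (hf : IsRanked f) :
    (Matrix.of fun i j : {v // v ≠ r} =>
      (if i = j then 1 else 0) - (if f i = j then 1 else 0 : R)).det = 1 := by
  obtain ⟨d, hd⟩ := hf
  have hb : Matrix.BlockTriangular (Matrix.of fun i j : {v // v ≠ r} =>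
      (if i = j then 1 else 0) - (if f i = j then 1 else 0 : R))
      -- The order is reversed because off-diagonal entries sit in columns of smaller rank.
      (fun i => OrderDual.toDual (d i)) := by
    intro i j hij
    have hij : d i < d j := hij
    have h₁ : i ≠ j := by rintro rfl; omega
    have h₂ : f i ≠ j := by
      intro h
      have := hd i
      rw [h] at this
      omega
    simp [h₁, h₂]
  rw [hb.det]
  refine Finset.prod_eq_one fun a _ => ?_
  rw [← Matrix.det_one (n := {i : {v // v ≠ r} // OrderDual.toDual (d i) = a})]
  congr 1
  ext ⟨i, hi⟩ ⟨j, hj⟩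
  have h : f i ≠ j := by
    intro h
    have := hd i
    rw [h] at this
    have : d i = d j := OrderDual.toDual.injective (hi.trans hj.symm)
    omega
  simp [Matrix.toSquareBlock_def, Matrix.one_apply, h]

/-- The indicator of the invariant set is a nonzero kernel vector. -/
theorem det_parent_of_not_isRanked [IsDomain R] {f : {v // v ≠ r} → V} (hf : ¬ IsRanked f) :
    (Matrix.of fun i j : {v // v ≠ r} =>
      (if i = j then 1 else 0) - (if f i = j then 1 else 0 : R)).det = 0 := by
  classical
  obtain ⟨C, hr, ⟨v, hv⟩, hC⟩ := exists_invariant_set_of_not_isRanked hf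
  rw [← Matrix.exists_mulVec_eq_zero_iff]
  refine ⟨fun i => if i.1 ∈ C then 1 else 0, fun h => ?_, ?_⟩
  · have := congrFun h ⟨v, fun h => hr (h ▸ hv)⟩
    simp [hv] at this
  · ext i
    simp only [Matrix.mulVec, dotProduct, Matrix.of_apply, sub_mul, Finset.sum_sub_distrib,
      ite_mul, one_mul, zero_mul, Finset.sum_ite_eq, Finset.mem_univ, if_true, Pi.zero_apply,
      sub_eq_zero]
    by_cases hi : f i = r
    · have h₁ : ∀ j : {v // v ≠ r}, f i ≠ j := fun j h => j.2 (h ▸ hi)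
      have h₂ : i.1 ∉ C := by rwa [hC, hi]
      simp [h₁, h₂]
    · rw [Finset.sum_eq_single ⟨f i, hi⟩]
      · simp [hC i]
      · intro j _ hj
        rw [if_neg]
        intro h
        exact hj (Subtype.ext h.symm)
      · simp

end MatrixTree

open scoped Classical in
/-- The weighted matrix-tree theorem: the weighted sum over spanning trees is the determinant of
the Laplacian with the row and the column of `r` removed. -/
theorem treeSum_eq_det {V : Type*} [Fintype V] {R : Type*} [CommRing R] [IsDomain R]
    (ω : Sym2 V → R) (r : V) :
    treeSum ω = (Matrix.of fun i j : {v // v ≠ r} =>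
          (if i = j then ∑ u, ω s(i.1, u) else 0) - ω s(i.1, j.1)).det := by
  -- Row `i` is `∑ u, ω s(i, u) • (e_i - e_u)` with `e_r = 0`. Multilinear expansion picks one `u`
  -- per row, that is, a parent map; its determinant is 1 or 0 according to rankedness.
  have hrow : (Matrix.of fun i j : {v // v ≠ r} =>
      (if i = j then ∑ u, ω s(i.1, u) else 0) - ω s(i.1, j.1)) =
      fun i => ∑ u, ω s(i.1, u) •
        fun j : {v // v ≠ r} => (if i = j then 1 else 0) - (if u = j then 1 else 0 : R) := by
    ext i j
    simp only [Matrix.of_apply, Finset.sum_apply, Pi.smul_apply, smul_eq_mul, mul_sub,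
      Finset.sum_sub_distrib, mul_ite, mul_one, mul_zero, Finset.sum_ite_eq', Finset.mem_univ,
      if_true]
    split_ifs <;> simp
  let D : MultilinearMap R (fun _ : {v // v ≠ r} => {v // v ≠ r} → R) R :=
    Matrix.detRowAlternating.toMultilinearMap
  rw [treeSum_eq_sum_isRanked ω r, hrow]
  refine Eq.trans ?_ (MultilinearMap.map_sum D _).symm
  rw [Finset.sum_filter]
  refine Finset.sum_congr rfl fun f _ => ?_
  rw [MultilinearMap.map_smul_univ]
  split_ifs with hf
  · refine (mul_one _).symm.trans (congrArg _ ?_)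
    exact (det_parent_of_isRanked hf).symm
  · refine (mul_zero _).symm.trans (congrArg _ ?_)
    exact (det_parent_of_not_isRanked hf).symm

/-! ### Evaluation for bilinear weights -/

/-- The determinant of a rank two perturbation of an invertible diagonal matrix. -/
theorem det_diagonal_sub_rank_two {n K : Type*} [Fintype n] [DecidableEq n] [Field K]
    (w x y : n → K) (hw : ∀ i, w i ≠ 0) :
    (Matrix.of fun i j => (if i = j then w i else 0) - (x i * y j + x j * y i)).det
      = (∏ i, w i) * ((1 - ∑ i, x i * y i / w i) ^ 2
          - (∑ i, x i ^ 2 / w i) * ∑ i, y i ^ 2 / w i) := by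
  -- The perturbation factors through `Fin 2`, and `det (1 - A * B) = det (1 - B * A)`.
  let A : Matrix n (Fin 2) K := Matrix.of fun i => ![x i / w i, y i / w i]
  let B : Matrix (Fin 2) n K := Matrix.of ![y, x]
  have h : (Matrix.of fun i j => (if i = j then w i else 0) - (x i * y j + x j * y i))
      = Matrix.diagonal w * (1 - A * B) := by
    ext i j
    rw [Matrix.diagonal_mul, Matrix.sub_apply, Matrix.mul_apply, Fin.sum_univ_two,
      Matrix.one_apply]
    simp only [A, B, Matrix.of_apply, Matrix.cons_val_zero, Matrix.cons_val_one]
    have := hw i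
    split_ifs
    · field_simp
    · field_simp
      ring
  rw [h, Matrix.det_mul, Matrix.det_diagonal, Matrix.det_one_sub_mul_comm, Matrix.det_fin_two]
  simp only [A, B, Matrix.sub_apply, Matrix.mul_apply, Matrix.of_apply, Matrix.cons_val_zero,
    Matrix.cons_val_one, Matrix.one_apply_eq, ne_eq, zero_ne_one, one_ne_zero, not_false_eq_true,
    Matrix.one_apply_ne, zero_sub]
  have h₁ : ∑ i, y i * (x i / w i) = ∑ i, x i * y i / w i :=
    Finset.sum_congr rfl fun i _ => by ring
  have h₂ : ∑ i, x i * (y i / w i) = ∑ i, x i * y i / w i :=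
    Finset.sum_congr rfl fun i _ => by ring
  have h₃ : ∑ i, x i * (x i / w i) = ∑ i, x i ^ 2 / w i :=
    Finset.sum_congr rfl fun i _ => by ring
  have h₄ : ∑ i, y i * (y i / w i) = ∑ i, y i ^ 2 / w i :=
    Finset.sum_congr rfl fun i _ => by ring
  rw [h₁, h₂, h₃, h₄]
  ring

/-- The weight `s(i, j) ↦ x i * y j + x j * y i`. -/
def bilinearWeight {V R : Type*} [CommRing R] (x y : V → R) : Sym2 V → R :=
  Sym2.lift ⟨fun i j => x i * y j + x j * y i, fun _ _ => add_comm _ _⟩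

theorem bilinearWeight_mk {V R : Type*} [CommRing R] (x y : V → R) (i j : V) :
    bilinearWeight x y s(i, j) = x i * y j + x j * y i := rfl

theorem map_bilinearWeight {V R S : Type*} [CommRing R] [CommRing S] (g : R →+* S) (x y : V → R)
    (e : Sym2 V) :
    g (bilinearWeight x y e) = bilinearWeight (fun i => g (x i)) (fun i => g (y i)) e := by
  induction e with
  | _ i j => simp [bilinearWeight_mk]

theorem treeSum_bilinearWeight {V K : Type*} [Fintype V] [Nonempty V] [Field K] (x y : V → K)
    (hX : ∑ i, x i ≠ 0) (hY : ∑ i, y i ≠ 0)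
    (hw : ∀ i, x i * (∑ j, y j) + y i * (∑ j, x j) ≠ 0) :
    treeSum (bilinearWeight x y)
      = 1 / ((∑ i, x i) * ∑ i, y i) * (∏ i, (x i * (∑ j, y j) + y i * ∑ j, x j))
        * (1 - ∑ i, x i * y i / (x i * (∑ j, y j) + y i * ∑ j, x j)) := by
  classical
  obtain ⟨r⟩ := ‹Nonempty V›
  have hsplit : ∀ f : V → K, ∑ i, f i = f r + ∑ i : {v // v ≠ r}, f i := fun f => by
    rw [Fintype.sum_eq_add_sum_subtype_ne f r]
  have hprod : ∀ f : V → K, ∏ i, f i = f r * ∏ i : {v // v ≠ r}, f i := fun f => by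
    rw [Fintype.prod_eq_mul_prod_subtype_ne f r]
  rw [treeSum_eq_det _ r]
  have hdeg : ∀ i, ∑ u, bilinearWeight x y s(i, u) = x i * (∑ j, y j) + y i * ∑ j, x j := by
    intro i
    simp only [bilinearWeight_mk, Finset.sum_add_distrib, ← Finset.mul_sum, ← Finset.sum_mul,
      mul_comm (y i)]
  simp only [hdeg]
  simp only [bilinearWeight_mk]
  generalize hXe : ∑ i, x i = X at *
  generalize hYe : ∑ i, y i = Y at *
  rw [det_diagonal_sub_rank_two (fun i : {v // v ≠ r} => x i * Y + y i * X)
    (fun i => x i) (fun i => y i) fun i => hw i, hprod, hsplit fun i => x i * y i / _]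
  have hx := hXe.symm.trans (hsplit x)
  have hy := hYe.symm.trans (hsplit y)
  -- Summing `x i = (x i ^ 2 * Y + x i * y i * X) / w i` over `i ≠ r`. With the analogue `hc`, this
  -- expresses the two square sums through the mixed sum `a`.
  have hb : (∑ i : {v // v ≠ r}, x i ^ 2 / (x i * Y + y i * X)) * Y
      + (∑ i : {v // v ≠ r}, x i * y i / (x i * Y + y i * X)) * X = X - x r := by
    rw [Finset.sum_mul, Finset.sum_mul, ← Finset.sum_add_distrib, eq_sub_iff_add_eq']
    refine Eq.trans (congrArg _ ?_) hx.symm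
    refine Finset.sum_congr rfl fun i _ => ?_
    have := hw i
    field_simp
  have hc : (∑ i : {v // v ≠ r}, y i ^ 2 / (x i * Y + y i * X)) * X
      + (∑ i : {v // v ≠ r}, x i * y i / (x i * Y + y i * X)) * Y = Y - y r := by
    rw [Finset.sum_mul, Finset.sum_mul, ← Finset.sum_add_distrib, eq_sub_iff_add_eq']
    refine Eq.trans (congrArg _ ?_) hy.symm
    refine Finset.sum_congr rfl fun i _ => ?_
    have := hw i
    field_simp
    ring
  have hr := hw r
  generalize (∑ i : {v // v ≠ r}, x i * y i / (x i * Y + y i * X)) = a at *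
  generalize (∑ i : {v // v ≠ r}, x i ^ 2 / (x i * Y + y i * X)) = b at *
  generalize (∑ i : {v // v ≠ r}, y i ^ 2 / (x i * Y + y i * X)) = c at *
  generalize (∏ i : {v // v ≠ r}, (x i * Y + y i * X)) = p
  obtain rfl : b = (X - x r - a * X) / Y := by
    rw [eq_div_iff hY]
    linear_combination hb
  obtain rfl : c = (Y - y r - a * Y) / X := by
    rw [eq_div_iff hX]
    linear_combination hc
  generalize hwr : x r * Y + y r * X = w at *
  field_simp
  rw [← hwr]
  ring

/-- The polynomial `phiPoly k` is the weighted sum over the spanning trees of the complete graph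
with edge weights `x_i y_j + x_j y_i`. -/
theorem phiPoly_eq_treeSum {k : ℕ} (hk : 1 ≤ k) :
    phiPoly k = treeSum (bilinearWeight xVar yVar) := by
  have inj := IsFractionRing.injective (XYPoly k) (XYRat k)
  have hX := (map_ne_zero_iff _ inj).2 (sum_xVar_ne_zero hk)
  have hY := (map_ne_zero_iff _ inj).2 (sum_yVar_ne_zero hk)
  have hw := fun i : Fin k => (map_ne_zero_iff _ inj).2 (denominator_ne_zero i)
  simp only [map_sum, map_add, map_mul] at hX hY hw
  have : Nonempty (Fin k) := ⟨⟨0, hk⟩⟩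
  apply inj
  simp only [algebraMap_phiPoly, map_treeSum, map_bilinearWeight]
  exact (treeSum_bilinearWeight _ _ hX hY hw).symm

theorem theorem4p2 (k : ℕ) (hk : 1 ≤ k) (ω : Sym2 (Fin k) → ℝ) (x y : Fin k → ℝ)
    (hω : ∀ i j : Fin k, i < j → ω s(i, j) = x i * y j + x j * y i) :
    weightedTreeSum (⊤ : SimpleGraph (Fin k)) ω = phi x y := by
  simp only [phi, phiPoly_eq_treeSum hk, map_treeSum, map_bilinearWeight, xVar, yVar,
    MvPolynomial.eval_X, Sum.elim_inl, Sum.elim_inr]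
  refine weightedTreeSum_top_eq_treeSum fun e => ?_
  induction e with
  | _ i j =>
    intro hij
    rw [bilinearWeight_mk]
    rcases lt_or_gt_of_ne (show i ≠ j from hij) with h | h
    · exact hω i j h
    · rw [Sym2.eq_swap, hω j i h, add_comm]
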